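/- Let $G=(V,E)$ be a polyhedral graph, i.e. a finite 3-connected planar simple graph. Let $\sim_{\mathrm c}$ be an equivalence relation on $V$ each of whose classes induces a connected subgraph of $G$. Let $\tilde G=G/{\sim_{\mathrm c}}$ be the contracted graph: its vertices are the classes, and two distinct classes $I,J$ are adjacent if $ij\in E$ for some $i\in I$, $j\in J$. Assume that $\tilde G$ is also polyhedral. Let $\Delta$ be a triangular face of $G$ (in a planar embedding) that persists in $\tilde G$, i.e. its three vertices lie in three different classes. Also write $\Delta$ for the image triangle in $\tilde G$, and write $E\setminus\Delta$ for the set of edges that are not edges of $\Delta$. Let $H$ be $G$ or $\tilde G$. A self-stress of a framework $(H,v)$ with $v\colon V(H)\to\mathbb R^2$ is a map $\omega\colon E(H)\to\mathbb R$ such that $\sum_{j:\,ij\in E(H)}\omega_{ij}(v_j-v_i)=0$ for each vertex $i$. A Tutte embedding of $H$ for a positive partial stress $\hat\omega\colon E(H)\setminus\Delta\to(0,\infty)$ is a triple $(H,v,\omega)$ such that $\omega$ is a self-stress of $(H,v)$ that extends $\hat\omega$ and the points $v_i$, $i\in\Delta$, are affinely independent. Let $\hat\omega^n\colon E\setminus\Delta\to(0,\infty)$,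 $n\in\mathbb N$, be partial stresses such that, for each $ij\in E\setminus\Delta$, $$\hat\omega^n_{ij}\to\hat\omega^*_{ij}\in(0,\infty)\ \text{ if } i\not\sim_{\mathrm c}j,\qquad \hat\omega^n_{ij}\to+\infty\ \text{ if } i\sim_{\mathrm c}j .$$ Fix affinely independent points $v^0_i\in\mathbb R^2$, $i\in\Delta$, and let $(G,v^n,\omega^n)$ be a Tutte embedding for $\hat\omega^n$ with $v^n_i=v^0_i$ for all $i\in\Delta$ and all $n$. On $E(\tilde G)\setminus\Delta$ define the contracted partial stress $$\hat{\tilde\omega}_{IJ}:=\sum_{ij\in E,\ i\in I,\ j\in J}\hat\omega^*_{ij}.$$ Then $\tilde G$ has a Tutte embedding $(\tilde G,\tilde v,\tilde\omega)$ for $\hat{\tilde\omega}$ with $\tilde v_{[i]}=v^0_i$ for all $i\in\Delta$. For every such Tutte embedding there are a map $v^*\colon V\to\mathbb R^2$ and a partial stress $\omega^*\colon\{ij\in E: i\not\sim_{\mathrm c}j\}\to\mathbb R$ that agrees with $\hat\omega^*$ off the edges of $\Delta$ such that: 1. $v^n_i\to v^*_i$ for every $i\in V$, and $\omega^n_{ij}\to\omega^*_{ij}$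 for every edge $ij\in E$ with $i\not\sim_{\mathrm c}j$ (including the edges of $\Delta$); 2. $v^*_i=\tilde v_I$ whenever $i\in I$, and $\tilde\omega_{IJ}=\sum_{ij\in E,\ i\in I,\ j\in J}\omega^*_{ij}$ for every edge $IJ$ of $\tilde G$. In particular, the limit determines $(\tilde G,\tilde v,\tilde\omega)$, which is therefore unique. -/

import Mathlib

open Filter Topology

namespace TutteLimit

/-- The Euclidean plane. -/
abbrev Plane : Type := EuclideanSpace ℝ (Fin 2)

section Polyhedral

variable {V : Type*}

/-- A graph is 3-connected if it has more than three vertices and stays connected whenever at most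
two vertices are deleted. -/
def IsThreeConnected (G : SimpleGraph V) : Prop :=
  4 ≤ Nat.card V ∧ ∀ S : Set V, S.ncard ≤ 2 → (G.induce Sᶜ).Connected

/-- A (topological) embedding of a graph into the plane: vertices are distinct points, each edge is
an injective arc between its end vertices, an arc contains no vertex besides its ends, and two
distinct arcs meet at most in common ends. The values of `arc` outside of the edge set play no
role. -/
structure PlaneEmbedding (G : SimpleGraph V) where
  point : V → Plane
  point_injective : Function.Injective point
  arc : Sym2 V → Set Plane
  arc_spec : ∀ i j : V, G.Adj i j →
    ∃ γ : Path (point i) (point j), Function.Injective γ ∧ Set.range γ = arc s(i, j)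
  arc_vertex : ∀ e ∈ G.edgeSet, ∀ k : V, point k ∈ arc e → k ∈ e
  arc_inter : ∀ e ∈ G.edgeSet, ∀ e' ∈ G.edgeSet, e ≠ e' →
    arc e ∩ arc e' ⊆ point '' {k | k ∈ e ∧ k ∈ e'}

/-- The point set covered by an embedded graph. -/
def PlaneEmbedding.image {G : SimpleGraph V} (D : PlaneEmbedding G) : Set Plane :=
  Set.range D.point ∪ ⋃ e ∈ G.edgeSet, D.arc e

/-- A polyhedral graph: a 3-connected planar graph. -/
def IsPolyhedral (G : SimpleGraph V) : Prop :=
  IsThreeConnected G ∧ Nonempty (PlaneEmbedding G)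

/-- The vertex set `Δ` is a triangular face of `G`: it consists of three pairwise adjacent vertices
and, in a plane embedding of `G`, the three arcs between them form the boundary of a connected
component of the complement of the embedded graph. (Embeddings of polyhedral graphs are
combinatorially unique, so that the choice of the embedding is irrelevant for these.) -/
def IsTriangularFace (G : SimpleGraph V) (Δ : Set V) : Prop :=
  Δ.ncard = 3 ∧ G.IsClique Δ ∧
    ∃ D : PlaneEmbedding G, ∃ x ∈ D.imageᶜ,
      frontier (connectedComponentIn D.imageᶜ x) =
        ⋃ e ∈ {e : Sym2 V | e ∈ G.edgeSet ∧ ∀ i ∈ e, i ∈ Δ}, D.arc e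

end Polyhedral

section Frameworks

variable {V : Type*}

/-- The edges of `G` that do not belong to the triangle `Δ`, that is, `E ∖ Δ`. -/
def edgesOff (G : SimpleGraph V) (Δ : Set V) : Set (Sym2 V) :=
  {e | e ∈ G.edgeSet ∧ ¬ ∀ i ∈ e, i ∈ Δ}

/-- `ω` is a self-stress of the planar framework `(G, p)`: the stress equilibrium condition
`∑ ω_ij (p_j - p_i) = 0` (sum over the neighbours `j` of `i`) holds at each vertex `i`.
A stress is a map on the edges; it is written as a map on all unordered pairs of which only the
values on edges are used. Graphs are finite, so that the `finsum` is an ordinary finite sum. -/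
def IsSelfStress (G : SimpleGraph V) (p : V → Plane) (ω : Sym2 V → ℝ) : Prop :=
  ∀ i : V, ∑ᶠ j ∈ G.neighborSet i, ω s(i, j) • (p j - p i) = 0

/-- `(G, v, ω)` is a Tutte embedding of `G` with outer triangle `Δ` for the positive partial stress
`ωhat` on `E ∖ Δ`: a self-stressed planar framework whose self-stress extends `ωhat` and
in which the outer triangle is non-degenerate. -/
structure IsTutteEmbedding (G : SimpleGraph V) (Δ : Set V) (ωhat : Sym2 V → ℝ)
    (v : V → Plane) (ω : Sym2 V → ℝ) : Prop where
  pos : ∀ e ∈ edgesOff G Δ, 0 < ωhat e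
  nondegenerate : AffineIndependent ℝ (fun i : Δ => v i)
  isSelfStress : IsSelfStress G v ω
  extends_partial : ∀ e ∈ edgesOff G Δ, ω e = ωhat e

end Frameworks

section Contraction

variable {V : Type*}

/-- The quotient by the equivalence relation `s` is a contraction-only minor of `G`: each
equivalence class induces a connected subgraph. -/
def IsContraction (G : SimpleGraph V) (s : Setoid V) : Prop :=
  ∀ I : Quotient s, (G.induce {i | Quotient.mk s i = I}).Connected

/-- The contracted graph: its vertices are the equivalence classes, and two distinct
classes `I`, `J` are adjacent if `ij` is an edge of `G` for some `i ∈ I` and `j ∈ J`. -/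
def contract (G : SimpleGraph V) (s : Setoid V) : SimpleGraph (Quotient s) :=
  G.map (Quotient.mk s)

/-- The face with vertex set `σ` persists if its vertices lie in at least three classes. -/
def Persists (s : Setoid V) (σ : Set V) : Prop :=
  3 ≤ (Quotient.mk s '' σ).ncard

/-- The contracted stress: its value on the edge `IJ` is the sum of `ω` over all edges `ij` of `G`
with `i ∈ I` and `j ∈ J`. -/
noncomputable def contractStress (G : SimpleGraph V) (s : Setoid V) (ω : Sym2 V → ℝ) :
    Sym2 (Quotient s) → ℝ :=
  fun E => ∑ᶠ e ∈ {e : Sym2 V | e ∈ G.edgeSet ∧ e.map (Quotient.mk s) = E}, ω e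

/-- `(G, v, ω) ≃ (G̃, ṽ, ω̃)`, where `ω` is a partial stress on the non-contracted edges. -/
def IsContractedFramework (G : SimpleGraph V) (s : Setoid V) (v : V → Plane) (ω : Sym2 V → ℝ)
    (v' : Quotient s → Plane) (ω' : Sym2 (Quotient s) → ℝ) : Prop :=
  (∀ i : V, v i = v' (Quotient.mk s i)) ∧
    ∀ E ∈ (contract G s).edgeSet, ω' E = contractStress G s ω E

/-- `(G, vⁿ, ωⁿ) → (G, v*, ω*)`: convergence of all vertices, and of the stresses of
all edges `ij` that are not contracted. -/
def FrameworksConverge (G : SimpleGraph V) (s : Setoid V) (v : ℕ → V → Plane)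
    (ω : ℕ → Sym2 V → ℝ) (vlim : V → Plane) (ωlim : Sym2 V → ℝ) : Prop :=
  (∀ i : V, Tendsto (fun n => v n i) atTop (𝓝 (vlim i))) ∧
    ∀ i j : V, G.Adj i j → Quotient.mk s i ≠ Quotient.mk s j →
      Tendsto (fun n => ω n s(i, j)) atTop (𝓝 (ωlim s(i, j)))

end Contraction

end TutteLimit

/-! Coordinate by coordinate, a self-stressed framework is a solution of a weighted Laplace
equation, and the weights are positive wherever the difference of two solutions with the same outer
triangle can vary. The proof is therefore an energy argument.

Let `x` be a coordinate of the n-th embedding, `y` the same coordinate of a given Tutte embedding of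
the contracted graph pulled back to `V`, and `u = x - y`, which vanishes on `Δ`. Equilibrium of `x`
expresses the weighted energy of `u` as a pairing with `y` over the edges off `Δ` between classes,
whose weights converge. Hence the energy is bounded, and the diverging weights force `u` to become
constant on each class. Replacing `u` by a function constant on classes turns the pairing into the
equilibrium of `y` on the contracted graph, which is zero. So the energy tends to zero, and
connectivity with `u = 0` on `Δ` gives `u → 0` (`tendsto_of_laplacian`).

Only the stresses on the triangle sides remain. Summing the equilibrium over the class of a corner
cancels all forces inside the class, including the divergent stresses, and leaves the two sides at
that corner as the only terms not known to converge (`tendsto_side_forces`). The sides are linearly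
independent, so both stresses converge.

Existence (`exists_isTutteEmbedding`) solves the Dirichlet problem and balances the residual forces
at the three corners by stresses on the sides. Uniqueness follows because every Tutte embedding of
the contracted graph is read off from the limit of the same sequence. -/

namespace TutteLimit

/-! ### Weighted Laplacians and the Dirichlet problem -/

section Weights

variable {V : Type*}

open Classical in
/-- The symmetric weight matrix of a stress. -/
noncomputable def weight (G : SimpleGraph V) (ω : Sym2 V → ℝ) (i j : V) : ℝ :=
  if G.Adj i j then ω s(i, j) else 0

lemma weight_of_adj {G : SimpleGraph V} {i j : V} (h : G.Adj i j) (ω : Sym2 V → ℝ) :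
    weight G ω i j = ω s(i, j) := if_pos h

lemma weight_of_not_adj {G : SimpleGraph V} {i j : V} (h : ¬ G.Adj i j) (ω : Sym2 V → ℝ) :
    weight G ω i j = 0 := if_neg h

lemma weight_comm (G : SimpleGraph V) (ω : Sym2 V → ℝ) (i j : V) :
    weight G ω i j = weight G ω j i := by
  by_cases h : G.Adj i j
  · rw [weight_of_adj h, weight_of_adj h.symm, Sym2.eq_swap]
  · rw [weight_of_not_adj h, weight_of_not_adj fun h' => h h'.symm]

lemma isSelfStress_iff [Fintype V] (G : SimpleGraph V) (p : V → Plane) (ω : Sym2 V → ℝ) :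
    IsSelfStress G p ω ↔ ∀ i k, ∑ j, weight G ω i j * (p j k - p i k) = 0 := by
  classical
  refine forall_congr' fun i => ?_
  have h : ∑ᶠ j ∈ G.neighborSet i, ω s(i, j) • (p j - p i) =
      ∑ j, weight G ω i j • (p j - p i) := by
    rw [finsum_eq_sum_of_fintype]
    refine Finset.sum_congr rfl fun j _ => ?_
    by_cases hj : G.Adj i j <;> simp [weight, hj, finsum_eq_if]
  rw [h]
  constructor
  · intro h k
    simpa using congrArg (fun x : Plane => x k) h
  · intro h
    ext k
    simpa using h k

lemma mem_edgesOff {G : SimpleGraph V} {Δ : Set V} {i j : V} :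
    s(i, j) ∈ edgesOff G Δ ↔ G.Adj i j ∧ ¬ (i ∈ Δ ∧ j ∈ Δ) := by
  simp only [edgesOff, Set.mem_ofPred_eq, SimpleGraph.mem_edgeSet, Sym2.ball]

lemma eq_of_reachable_of_adj {G : SimpleGraph V} {x : V → ℝ} (h : ∀ i j, G.Adj i j → x i = x j)
    {i j : V} (hij : G.Reachable i j) : x i = x j := by
  obtain ⟨p⟩ := hij
  induction p with
  | nil => rfl
  | cons hadj _ ih => exact (h _ _ hadj).trans ih

variable [Fintype V]

/-- Summation by parts. -/
lemma sum_mul_laplacian (w : V → V → ℝ) (hw : ∀ i j, w i j = w j i) (x z : V → ℝ) :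
    ∑ i, z i * ∑ j, w i j * (x j - x i) =
      -(∑ i, ∑ j, w i j * (x j - x i) * (z j - z i)) / 2 := by
  have h1 : ∑ i, z i * ∑ j, w i j * (x j - x i) = ∑ i, ∑ j, w i j * (x j - x i) * z i := by
    refine Finset.sum_congr rfl fun i _ => ?_
    rw [Finset.mul_sum]
    exact Finset.sum_congr rfl fun j _ => by ring
  have h2 : ∑ i, ∑ j, w i j * (x j - x i) * z j = -∑ i, ∑ j, w i j * (x j - x i) * z i := by
    rw [Finset.sum_comm, ← Finset.sum_neg_distrib]
    refine Finset.sum_congr rfl fun i _ => ?_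
    rw [← Finset.sum_neg_distrib]
    exact Finset.sum_congr rfl fun j _ => by rw [hw j i]; ring
  have h3 : ∑ i, ∑ j, w i j * (x j - x i) * (z j - z i) =
      ∑ i, ∑ j, w i j * (x j - x i) * z j - ∑ i, ∑ j, w i j * (x j - x i) * z i := by
    simp only [← Finset.sum_sub_distrib, mul_sub]
  rw [h1, h3, h2]; ring

lemma sum_antisymm_block (P : V → Prop) [DecidablePred P] (f : V → V → ℝ)
    (hf : ∀ i j, f i j = -f j i) : ∑ i with P i, ∑ j with P j, f i j = 0 := by
  have h : ∑ i with P i, ∑ j with P j, f i j = -∑ i with P i, ∑ j with P j, f i j := by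
    conv_lhs => rw [Finset.sum_comm]
    simp only [← Finset.sum_neg_distrib]
    exact Finset.sum_congr rfl fun i _ => Finset.sum_congr rfl fun j _ => hf j i
  linarith

/-- The discrete Dirichlet problem is solvable on a connected graph. -/
lemma exists_harmonic {G : SimpleGraph V} (hG : G.Connected) {Δ : Set V} (hΔ : Δ.Nonempty)
    (w : V → V → ℝ) (hw : ∀ i j, w i j = w j i) (hw0 : ∀ i j, 0 ≤ w i j)
    (hpos : ∀ i j, s(i, j) ∈ edgesOff G Δ → 0 < w i j) (x₀ : V → ℝ) :
    ∃ x : V → ℝ, (∀ i ∈ Δ, x i = x₀ i) ∧ ∀ i ∉ Δ, ∑ j, w i j * (x j - x i) = 0 := by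
  classical
  -- Boundary values and interior equations form one square linear system, so uniqueness implies
  -- solvability.
  let L : (V → ℝ) →ₗ[ℝ] (V → ℝ) :=
    { toFun := fun x i => if i ∈ Δ then x i else ∑ j, w i j * (x j - x i)
      map_add' := fun x y => by
        ext i
        by_cases hi : i ∈ Δ
        · simp [hi]
        · simp only [hi, if_false, Pi.add_apply, ← Finset.sum_add_distrib]
          exact Finset.sum_congr rfl fun j _ => by ring
      map_smul' := fun c x => by
        ext i
        by_cases hi : i ∈ Δ
        · simp [hi]
        · simp only [hi, if_false, Pi.smul_apply, smul_eq_mul, RingHom.id_apply, Finset.mul_sum]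
          exact Finset.sum_congr rfl fun j _ => by ring }
  have hL : ∀ x i, L x i = if i ∈ Δ then x i else ∑ j, w i j * (x j - x i) := fun _ _ => rfl
  have hinj : Function.Injective L := by
    rw [← LinearMap.ker_eq_bot, LinearMap.ker_eq_bot']
    intro x hx
    have hΔ0 : ∀ i ∈ Δ, x i = 0 := fun i hi => by
      simpa [hL, hi] using congrFun hx i
    have hharm : ∀ i ∉ Δ, ∑ j, w i j * (x j - x i) = 0 := fun i hi => by
      simpa [hL, hi] using congrFun hx i
    -- Each summand of `∑ i, x i * (Laplacian of x at i)` has a vanishing factor, so the energy is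
    -- zero and `x` is constant along edges.
    have hE : ∑ i, ∑ j, w i j * (x j - x i) * (x j - x i) = 0 := by
      have h := sum_mul_laplacian w hw x x
      have h0 : ∑ i, x i * ∑ j, w i j * (x j - x i) = 0 :=
        Finset.sum_eq_zero fun i _ => by
          by_cases hi : i ∈ Δ
          · rw [hΔ0 i hi, zero_mul]
          · rw [hharm i hi, mul_zero]
      linarith
    have hnn : ∀ i j, 0 ≤ w i j * (x j - x i) * (x j - x i) := fun i j => by
      rw [mul_assoc]; exact mul_nonneg (hw0 i j) (mul_self_nonneg _)
    have hterm : ∀ i j, w i j * (x j - x i) * (x j - x i) = 0 := fun i j => by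
      have h1 := (Finset.sum_eq_zero_iff_of_nonneg
        fun i _ => Finset.sum_nonneg fun j _ => hnn i j).1 hE i (Finset.mem_univ _)
      exact (Finset.sum_eq_zero_iff_of_nonneg fun j _ => hnn i j).1 h1 j (Finset.mem_univ _)
    have hadj : ∀ i j, G.Adj i j → x i = x j := fun i j hij => by
      by_cases hoff : s(i, j) ∈ edgesOff G Δ
      · have := hterm i j
        have hp := hpos i j hoff
        rcases mul_eq_zero.1 this with h | h
        · rcases mul_eq_zero.1 h with h | h <;> linarith
        · linarith
      · rw [mem_edgesOff] at hoff
        have h2 : i ∈ Δ ∧ j ∈ Δ := by tauto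
        rw [hΔ0 i h2.1, hΔ0 j h2.2]
    obtain ⟨a, ha⟩ := hΔ
    ext i
    rw [eq_of_reachable_of_adj hadj (hG.preconnected i a), hΔ0 a ha]; rfl
  obtain ⟨x, hx⟩ := (LinearMap.injective_iff_surjective.1 hinj) fun i => if i ∈ Δ then x₀ i else 0
  refine ⟨x, fun i hi => ?_, fun i hi => ?_⟩
  · simpa [hL, hi] using congrFun hx i
  · simpa [hL, hi] using congrFun hx i

end Weights

/-! ### Forces on a nondegenerate triangle -/

section Triangle

lemma det_ne_zero_of_affineIndependent {V : Type*} {Δ : Set V} {p : V → Plane}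
    (h : AffineIndependent ℝ (fun i : Δ => p i)) {a b c : V} (ha : a ∈ Δ) (hb : b ∈ Δ) (hc : c ∈ Δ)
    (hab : a ≠ b) (hac : a ≠ c) (hbc : b ≠ c) :
    (p b 0 - p a 0) * (p c 1 - p a 1) - (p b 1 - p a 1) * (p c 0 - p a 0) ≠ 0 := by
  classical
  intro hD
  let f : Fin 3 ↪ Δ := ⟨![⟨a, ha⟩, ⟨b, hb⟩, ⟨c, hc⟩], by
    intro i j hij
    fin_cases i <;> fin_cases j <;> simp_all⟩
  have h3 := h.comp_embedding f
  rw [affineIndependent_iff] at h3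
  have key : ∀ α β : ℝ, (∀ k, α * (p b k - p a k) + β * (p c k - p a k) = 0) →
      α = 0 ∧ β = 0 := by
    intro α β hk
    have := h3 Finset.univ ![-α - β, α, β] (by simp [Fin.sum_univ_three]; ring) (by
      ext k
      have := hk k
      have hf0 : f 0 = ⟨a, ha⟩ := rfl
      have hf1 : f 1 = ⟨b, hb⟩ := rfl
      have hf2 : f 2 = ⟨c, hc⟩ := rfl
      simp [Fin.sum_univ_three, hf0, hf1, hf2]
      linarith)
    exact ⟨by simpa using this 1 (Finset.mem_univ _), by simpa using this 2 (Finset.mem_univ _)⟩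
  -- If the determinant vanishes, each coordinate row of the side vectors yields a linear dependence
  -- between them, so that row is zero. Both side vectors then vanish, and `(0, 1)` is a nontrivial
  -- dependence.
  obtain ⟨h1, h2⟩ := key (p c 0 - p a 0) (-(p b 0 - p a 0)) (by
    rw [Fin.forall_fin_two]; exact ⟨by ring, by linarith⟩)
  obtain ⟨h4, h5⟩ := key (p c 1 - p a 1) (-(p b 1 - p a 1)) (by
    rw [Fin.forall_fin_two]; exact ⟨by linarith, by ring⟩)
  have h6 := (key 0 1 (by rw [Fin.forall_fin_two]; exact ⟨by linarith, by linarith⟩)).2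
  exact one_ne_zero h6

/-- Three forces in equilibrium are resolved by stresses along the sides of a triangle. -/
lemma exists_triangle_stress (a b c A B C : Fin 2 → ℝ)
    (hD : (b 0 - a 0) * (c 1 - a 1) - (b 1 - a 1) * (c 0 - a 0) ≠ 0)
    (hF : ∀ k, A k + B k + C k = 0)
    (hT : (A 0 * a 1 - A 1 * a 0) + (B 0 * b 1 - B 1 * b 0) + (C 0 * c 1 - C 1 * c 0) = 0) :
    ∃ x y z : ℝ, ∀ k, A k + z * (b k - a k) + y * (c k - a k) = 0 ∧
      B k + z * (a k - b k) + x * (c k - b k) = 0 ∧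
      C k + y * (a k - c k) + x * (b k - c k) = 0 := by
  obtain ⟨D, hDe⟩ : ∃ D, D = (b 0 - a 0) * (c 1 - a 1) - (b 1 - a 1) * (c 0 - a 0) := ⟨_, rfl⟩
  rw [← hDe] at hD
  have h0 := hF 0
  have h1 := hF 1
  have hA : ∀ k, A k + (-(A 0 * (c 1 - a 1) - A 1 * (c 0 - a 0)) / D) * (b k - a k) +
      ((A 0 * (b 1 - a 1) - A 1 * (b 0 - a 0)) / D) * (c k - a k) = 0 := by
    rw [Fin.forall_fin_two]
    constructor <;> field_simp <;> rw [hDe] <;> ring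
  -- The coefficient of side `ab` is already fixed by Cramer's rule at `a`; zero total torque is
  -- what makes it fit at `b` as well.
  have hB : ∀ k, B k + (-(A 0 * (c 1 - a 1) - A 1 * (c 0 - a 0)) / D) * (a k - b k) +
      (-(B 0 * (a 1 - b 1) - B 1 * (a 0 - b 0)) / D) * (c k - b k) = 0 := by
    have hC0 : C 0 = -A 0 - B 0 := by linarith
    have hC1 : C 1 = -A 1 - B 1 := by linarith
    rw [hC0, hC1] at hT
    rw [Fin.forall_fin_two]
    constructor <;> field_simp <;> rw [hDe]
    · linear_combination (a 0 - b 0) * hT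
    · linear_combination (a 1 - b 1) * hT
  refine ⟨_, _, _, fun k => ⟨hA k, hB k, ?_⟩⟩
  linear_combination hF k - hA k - hB k

lemma tendsto_zero_of_det_ne_zero {u v : Fin 2 → ℝ} (hD : u 0 * v 1 - u 1 * v 0 ≠ 0)
    {α β : ℕ → ℝ} (h : ∀ k, Tendsto (fun n => α n * u k + β n * v k) atTop (𝓝 0)) :
    Tendsto α atTop (𝓝 0) := by
  have h1 := (((h 0).mul_const (v 1)).sub ((h 1).mul_const (v 0))).div_const
    (u 0 * v 1 - u 1 * v 0)
  simp only [zero_mul, sub_zero, zero_div] at h1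
  refine h1.congr fun n => ?_
  rw [div_eq_iff hD]; ring

end Triangle

/-! ### Existence of Tutte embeddings -/

section Existence

variable {V : Type*} [Fintype V]

/-- Each coordinate is extended harmonically from the triangle. Equilibrium can then fail only at
the corners, and summation by parts shows that the residual forces there have zero sum and zero
torque, so stresses on the sides can absorb them. -/
lemma exists_isTutteEmbedding {G : SimpleGraph V} (hG : G.Connected) {a b c : V}
    (hab : G.Adj a b) (hac : G.Adj a c) (hbc : G.Adj b c) {ωhat : Sym2 V → ℝ}
    (hpos : ∀ e ∈ edgesOff G {a, b, c}, 0 < ωhat e) (p₀ : V → Plane)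
    (hp₀ : AffineIndependent ℝ (fun i : ({a, b, c} : Set V) => p₀ i)) :
    ∃ v ω, IsTutteEmbedding G {a, b, c} ωhat v ω ∧ ∀ i ∈ ({a, b, c} : Set V), v i = p₀ i := by
  classical
  set Δ : Set V := {a, b, c} with hΔ
  have ha : a ∈ Δ := by simp [hΔ]
  have hb : b ∈ Δ := by simp [hΔ]
  have hc : c ∈ Δ := by simp [hΔ]
  -- The sides carry weight zero for now; their stresses are chosen last.
  let w : V → V → ℝ := weight G fun e => if e ∈ edgesOff G Δ then ωhat e else 0
  have hw : ∀ i j, w i j = w j i := weight_comm _ _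
  have hwoff : ∀ i j, s(i, j) ∈ edgesOff G Δ → w i j = ωhat s(i, j) := fun i j h => by
    simp only [w, weight_of_adj (mem_edgesOff.1 h).1, if_pos h]
  have hwin : ∀ i j, s(i, j) ∉ edgesOff G Δ → w i j = 0 := fun i j h => by
    simp only [w, weight, if_neg h, ite_self]
  have hw0 : ∀ i j, 0 ≤ w i j := fun i j => by
    by_cases h : s(i, j) ∈ edgesOff G Δ
    · rw [hwoff i j h]; exact (hpos _ h).le
    · rw [hwin i j h]
  choose x hxΔ hx using fun k : Fin 2 => exists_harmonic hG ⟨a, ha⟩ w hw hw0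
    (fun i j h => by rw [hwoff i j h]; exact hpos _ h) (fun i => p₀ i k)
  let F : V → Fin 2 → ℝ := fun i k => ∑ j, w i j * (x k j - x k i)
  have hsum : ∀ f : V → ℝ, (∀ i ∉ Δ, f i = 0) → ∑ i, f i = f a + f b + f c := by
    intro f hf
    rw [← Finset.sum_subset (Finset.subset_univ {a, b, c})
      fun i _ hi => hf i (by simpa [hΔ] using hi)]
    rw [Finset.sum_insert (by simp [hab.ne, hac.ne]), Finset.sum_pair hbc.ne]; ring
  have hF0 : ∀ i ∉ Δ, ∀ k, F i k = 0 := fun i hi k => hx k i hi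
  have hwk : ∀ (z : V → ℝ) k, z a * F a k + z b * F b k + z c * F c k =
      -(∑ i, ∑ j, w i j * (x k j - x k i) * (z j - z i)) / 2 := fun z k => by
    rw [← sum_mul_laplacian w hw, hsum _ fun i hi => by
      rw [show ∑ j, w i j * (x k j - x k i) = 0 from hF0 i hi k, mul_zero]]
  obtain ⟨X, Y, Z, hXYZ⟩ := exists_triangle_stress (fun k => x k a) (fun k => x k b)
    (fun k => x k c) (F a) (F b) (F c)
    (by simpa [hxΔ, ha, hb, hc] using
      det_ne_zero_of_affineIndependent hp₀ ha hb hc hab.ne hac.ne hbc.ne)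
    (fun k => by simpa using hwk (fun _ => 1) k)
    -- The torque is the difference of the pairings of one coordinate with the other, which agree
    -- because the energy form is symmetric.
    (by
      have h1 := hwk (x 1) 0
      have h2 := hwk (x 0) 1
      have h3 : ∑ i, ∑ j, w i j * (x 0 j - x 0 i) * (x 1 j - x 1 i) =
          ∑ i, ∑ j, w i j * (x 1 j - x 1 i) * (x 0 j - x 0 i) :=
        Finset.sum_congr rfl fun i _ => Finset.sum_congr rfl fun j _ => by ring
      linarith)
  let ω : Sym2 V → ℝ := fun e => if e ∈ edgesOff G Δ then ωhat e else
    if e = s(a, b) then Z else if e = s(a, c) then Y else X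
  have hval : ∀ i j, i ∈ Δ → j ∈ Δ → ω s(i, j) =
      if s(i, j) = s(a, b) then Z else if s(i, j) = s(a, c) then Y else X := fun i j hi hj =>
    if_neg fun h => (mem_edgesOff.1 h).2 ⟨hi, hj⟩
  have hω : ∀ i k, ∑ j, weight G ω i j * (x k j - x k i) = F i k +
      ∑ j, (if i ∈ Δ ∧ j ∈ Δ then ω s(i, j) else 0) * (x k j - x k i) := by
    intro i k
    rw [← Finset.sum_add_distrib]
    refine Finset.sum_congr rfl fun j _ => ?_
    rw [← add_mul]
    by_cases hij : i = j
    · simp [hij]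
    congr 1
    by_cases h : s(i, j) ∈ edgesOff G Δ
    · rw [hwoff i j h, weight_of_adj (mem_edgesOff.1 h).1, if_neg (mem_edgesOff.1 h).2, add_zero]
      exact if_pos h
    · rw [hwin i j h, zero_add]
      by_cases h2 : i ∈ Δ ∧ j ∈ Δ
      · rw [if_pos h2, weight_of_adj]
        obtain ⟨h3, h4⟩ := h2
        simp only [hΔ, Set.mem_insert_iff, Set.mem_singleton_iff] at h3 h4
        rcases h3 with rfl | rfl | rfl <;> rcases h4 with rfl | rfl | rfl <;>
          first
            | exact absurd rfl hij
            | assumption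
            | exact SimpleGraph.Adj.symm ‹_›
      · rw [if_neg h2, weight_of_not_adj]
        exact fun h3 => h (mem_edgesOff.2 ⟨h3, h2⟩)
  refine ⟨fun i => WithLp.toLp 2 fun k => x k i, ω, ⟨hpos, ?_, ?_, fun e he => if_pos he⟩, ?_⟩
  · convert hp₀ using 2 with i
    ext k
    simp [hxΔ k i i.2]
  · rw [isSelfStress_iff]
    intro i k
    rw [show ∑ j, weight G ω i j * ((WithLp.toLp 2 fun k => x k j : Plane) k -
      (WithLp.toLp 2 fun k => x k i : Plane) k) = ∑ j, weight G ω i j * (x k j - x k i) from rfl, hω]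
    by_cases hi : i ∈ Δ
    · rw [hsum _ fun j hj => by rw [if_neg fun h => hj h.2, zero_mul]]
      obtain ⟨h1, h2, h3⟩ := hXYZ k
      have hi' := hi
      simp only [hΔ, Set.mem_insert_iff, Set.mem_singleton_iff] at hi'
      have := hab.ne
      have := hac.ne
      have := hbc.ne
      rcases hi' with rfl | rfl | rfl
      · rw [if_pos ⟨ha, ha⟩, if_pos ⟨ha, hb⟩, if_pos ⟨ha, hc⟩, hval _ _ ha hb, hval _ _ ha hc]
        rw [if_pos rfl, if_neg (by simp; grind), if_pos rfl]
        linarith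
      · rw [if_pos ⟨hb, ha⟩, if_pos ⟨hb, hb⟩, if_pos ⟨hb, hc⟩, hval _ _ hb ha, hval _ _ hb hc]
        rw [if_pos Sym2.eq_swap, if_neg (by simp; grind), if_neg (by simp; grind)]
        linarith
      · rw [if_pos ⟨hc, ha⟩, if_pos ⟨hc, hb⟩, if_pos ⟨hc, hc⟩, hval _ _ hc ha, hval _ _ hc hb]
        rw [if_neg (by simp; grind), if_pos Sym2.eq_swap, if_neg (by simp; grind),
          if_neg (by simp; grind)]
        linarith
    · rw [hF0 i hi k, zero_add]
      exact Finset.sum_eq_zero fun j _ => by rw [if_neg fun h => hi h.1, zero_mul]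
  · intro i hi
    ext k
    simp [hxΔ k i hi]

end Existence

/-! ### Convergence of the vertices by an energy estimate -/

section Convergence

lemma tendsto_sub_of_reachable {V : Type*} {G : SimpleGraph V} {f : ℕ → V → ℝ}
    (h : ∀ i j, G.Adj i j → Tendsto (fun n => f n j - f n i) atTop (𝓝 0))
    {i j : V} (hij : G.Reachable i j) : Tendsto (fun n => f n j - f n i) atTop (𝓝 0) := by
  obtain ⟨p⟩ := hij
  induction p with
  | nil => simp
  | cons hadj _ ih => simpa using (h _ _ hadj).add ih

lemma tendsto_zero_of_sq {f : ℕ → ℝ} (h : Tendsto (fun n => f n ^ 2) atTop (𝓝 0)) :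
    Tendsto f atTop (𝓝 0) := by
  rw [tendsto_zero_iff_abs_tendsto_zero]
  have := (Real.continuous_sqrt.tendsto 0).comp h
  simpa [Function.comp_def, Real.sqrt_sq_eq_abs] using this

/-- Corners represent their own classes, so that a function vanishing on `Δ` still does so after
being replaced by its values at representatives. -/
lemma exists_section {V : Type*} (s : Setoid V) {Δ : Set V}
    (hinj : ∀ i ∈ Δ, ∀ j ∈ Δ, Quotient.mk s i = Quotient.mk s j → i = j) :
    ∃ r : Quotient s → V, (∀ I, Quotient.mk s (r I) = I) ∧ ∀ a ∈ Δ, r (Quotient.mk s a) = a := by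
  have h : ∀ I : Quotient s, ∃ i, Quotient.mk s i = I ∧ ∀ a ∈ Δ, Quotient.mk s a = I → i = a := by
    intro I
    by_cases h : ∃ a ∈ Δ, Quotient.mk s a = I
    · obtain ⟨a, ha, haI⟩ := h
      exact ⟨a, haI, fun b hb hbI => hinj a ha b hb (haI.trans hbI.symm)⟩
    · obtain ⟨i, hi⟩ := Quotient.exists_rep I
      exact ⟨i, hi, fun a ha haI => absurd ⟨a, ha, haI⟩ h⟩
  choose r hr hrΔ using h
  exact ⟨r, hr, fun a ha => hrΔ _ a ha rfl⟩

variable {V : Type*} [Fintype V]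

open Classical in
/-- Solutions of weighted Dirichlet problems converge to the solution on the contracted graph if
the weights inside the classes tend to infinity. -/
lemma tendsto_of_laplacian {G : SimpleGraph V} (hG : G.Connected) {s : Setoid V}
    (hs : IsContraction G s) {Δ : Set V} (hΔ : Δ.Nonempty)
    (hinj : ∀ i ∈ Δ, ∀ j ∈ Δ, Quotient.mk s i = Quotient.mk s j → i = j)
    {w : ℕ → V → V → ℝ} {wl : V → V → ℝ}
    (hw : ∀ n i j, w n i j = w n j i) (hwl : ∀ i j, wl i j = wl j i)
    (hw0 : ∀ n i j, ¬ G.Adj i j → w n i j = 0) (hwl0 : ∀ i j, ¬ G.Adj i j → wl i j = 0)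
    (hpos : ∀ n i j, s(i, j) ∈ edgesOff G Δ → 0 < w n i j)
    (hlim : ∀ i j, s(i, j) ∈ edgesOff G Δ → Quotient.mk s i ≠ Quotient.mk s j →
      0 < wl i j ∧ Tendsto (fun n => w n i j) atTop (𝓝 (wl i j)))
    (hdiv : ∀ i j, s(i, j) ∈ edgesOff G Δ → Quotient.mk s i = Quotient.mk s j →
      Tendsto (fun n => w n i j) atTop atTop)
    {x : ℕ → V → ℝ} {y : V → ℝ}
    (hy : ∀ i j, Quotient.mk s i = Quotient.mk s j → y i = y j)
    (hx : ∀ n i, ∑ j, w n i j * (x n j - x n i) = 0)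
    (hyl : ∀ I, ∑ i with Quotient.mk s i = I, ∑ j, wl i j * (y j - y i) = 0)
    (hxy : ∀ n, ∀ i ∈ Δ, x n i = y i) (i : V) :
    Tendsto (fun n => x n i) atTop (𝓝 (y i)) := by
  obtain ⟨r, hr, hrΔ⟩ := exists_section s hinj
  let u : ℕ → V → ℝ := fun n i => x n i - y i
  have huΔ : ∀ n, ∀ i ∈ Δ, u n i = 0 := fun n i hi => by simp [u, hxy n i hi]
  let ur : ℕ → V → ℝ := fun n i => u n (r (Quotient.mk s i))
  have hurΔ : ∀ n, ∀ i ∈ Δ, ur n i = 0 := fun n i hi => by simp [ur, hrΔ i hi, huΔ n i hi]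
  let P : V → V → Prop := fun i j => s(i, j) ∈ edgesOff G Δ ∧ Quotient.mk s i ≠ Quotient.mk s j
  let wo : ℕ → V → V → ℝ := fun n i j => if P i j then w n i j else 0
  let wol : V → V → ℝ := fun i j => if P i j then wl i j else 0
  have hcases : ∀ i j, ¬ P i j → ¬ G.Adj i j ∨ (i ∈ Δ ∧ j ∈ Δ) ∨
      Quotient.mk s i = Quotient.mk s j := by
    intro i j h
    simp only [P, mem_edgesOff] at h
    tauto
  have hwo : ∀ i j, Tendsto (fun n => wo n i j) atTop (𝓝 (wol i j)) := by
    intro i j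
    by_cases h : P i j
    · simpa only [wo, wol, if_pos h] using (hlim i j h.1 h.2).2
    · simp only [wo, wol, if_neg h, tendsto_const_nhds]
  -- The sides of the triangle may carry stress of any sign, but `u` vanishes at both of their ends.
  have hnn : ∀ n i j, 0 ≤ w n i j * (u n j - u n i) ^ 2 := by
    intro n i j
    by_cases h : s(i, j) ∈ edgesOff G Δ
    · exact mul_nonneg (hpos n i j h).le (sq_nonneg _)
    · rw [mem_edgesOff] at h
      by_cases hadj : G.Adj i j
      · have h2 : i ∈ Δ ∧ j ∈ Δ := by tauto
        simp [huΔ n i h2.1, huΔ n j h2.2]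
      · simp [hw0 n i j hadj]
  let Q : ℕ → ℝ := fun n => ∑ i, ∑ j, w n i j * (u n j - u n i) ^ 2
  have hQ : ∀ n, Q n = -∑ i, ∑ j, wo n i j * (y j - y i) * (u n j - u n i) := by
    intro n
    have h1 := sum_mul_laplacian (w n) (hw n) (x n) (u n)
    simp only [hx, mul_zero, Finset.sum_const_zero] at h1
    have h2 : ∑ i, ∑ j, w n i j * (x n j - x n i) * (u n j - u n i) =
        Q n + ∑ i, ∑ j, wo n i j * (y j - y i) * (u n j - u n i) := by
      simp only [Q, ← Finset.sum_add_distrib]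
      refine Finset.sum_congr rfl fun i _ => Finset.sum_congr rfl fun j _ => ?_
      have h3 : x n j - x n i = (u n j - u n i) + (y j - y i) := by simp only [u]; ring
      by_cases h : P i j
      · simp only [wo, if_pos h, h3]; ring
      · simp only [wo, if_neg h, zero_mul, add_zero, h3]
        rcases hcases i j h with h | h | h
        · simp [hw0 n i j h]
        · simp [huΔ n i h.1, huΔ n j h.2]
        · rw [hy i j h]; ring
    linarith
  -- From `-w·α·β ≤ w·α²/2 + w·β²/2`: half of `Q` is absorbed on the left, and the bound involves
  -- only convergent weights.
  have hQle : ∀ n, Q n ≤ ∑ i, ∑ j, wo n i j * (y j - y i) ^ 2 := by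
    intro n
    have h : Q n ≤ ∑ i, ∑ j, (wo n i j * (y j - y i) ^ 2 / 2 +
        w n i j * (u n j - u n i) ^ 2 / 2) := by
      rw [hQ, ← Finset.sum_neg_distrib]
      refine Finset.sum_le_sum fun i _ => ?_
      rw [← Finset.sum_neg_distrib]
      refine Finset.sum_le_sum fun j _ => ?_
      by_cases h : P i j
      · simp only [wo, if_pos h]
        have := mul_nonneg (hpos n i j h.1).le (sq_nonneg ((y j - y i) + (u n j - u n i)))
        linarith
      · simp only [wo, if_neg h]
        have := hnn n i j
        linarith
    simp only [Finset.sum_add_distrib, ← Finset.sum_div] at h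
    have h2 : Q n = ∑ i, ∑ j, w n i j * (u n j - u n i) ^ 2 := rfl
    linarith
  obtain ⟨C, hC⟩ : ∃ C, ∀ᶠ n in atTop, Q n ≤ C := by
    have h : Tendsto (fun n => ∑ i, ∑ j, wo n i j * (y j - y i) ^ 2) atTop
        (𝓝 (∑ i, ∑ j, wol i j * (y j - y i) ^ 2)) :=
      tendsto_finsetSum _ fun i _ => tendsto_finsetSum _ fun j _ => (hwo i j).mul_const _
    refine ⟨_, (h.eventually_le_const (lt_add_one _)).mono fun n hn => (hQle n).trans hn⟩
  have hterm : ∀ n i j, w n i j * (u n j - u n i) ^ 2 ≤ Q n := fun n i j =>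
    (Finset.single_le_sum (f := fun j => w n i j * (u n j - u n i) ^ 2)
      (fun j _ => hnn n i j) (Finset.mem_univ j)).trans
    (Finset.single_le_sum (f := fun i => ∑ j, w n i j * (u n j - u n i) ^ 2)
      (fun i _ => Finset.sum_nonneg fun j _ => hnn n i j) (Finset.mem_univ i))
  have hctr : ∀ i j, G.Adj i j → Quotient.mk s i = Quotient.mk s j →
      Tendsto (fun n => u n j - u n i) atTop (𝓝 0) := by
    intro i j hij hI
    have hoff : s(i, j) ∈ edgesOff G Δ :=
      mem_edgesOff.2 ⟨hij, fun h => hij.ne (hinj i h.1 j h.2 hI)⟩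
    refine tendsto_zero_of_sq (squeeze_zero' (Eventually.of_forall fun n => sq_nonneg _)
      (hC.mono fun n hn => ?_) ((hdiv i j hoff hI).const_div_atTop C))
    rw [le_div_iff₀' (hpos n i j hoff)]
    exact (hterm n i j).trans hn
  have hur : ∀ i, Tendsto (fun n => u n i - ur n i) atTop (𝓝 0) := by
    intro i
    have hconn := (hs (Quotient.mk s i)).preconnected ⟨r (Quotient.mk s i), hr _⟩ ⟨i, rfl⟩
    exact tendsto_sub_of_reachable (f := fun n (k : {k | Quotient.mk s k = Quotient.mk s i}) =>
      u n k) (fun k l hkl => hctr k l hkl (k.2.trans l.2.symm)) hconn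
  have hbdd : ∀ i j, P i j → ∀ᶠ n in atTop, |u n j - u n i| ≤ √(C / (wl i j / 2)) := by
    intro i j h
    obtain ⟨h1, h2⟩ := hlim i j h.1 h.2
    filter_upwards [hC, h2.eventually_const_le (half_lt_self h1)] with n hn hn2
    apply Real.abs_le_sqrt
    rw [le_div_iff₀' (half_pos h1)]
    exact (mul_le_mul_of_nonneg_right hn2 (sq_nonneg _)).trans ((hterm n i j).trans hn)
  -- `ur` is constant on classes, so testing with it needs the equilibrium of `y` only summed over
  -- each class.
  have hzero : ∀ n, ∑ i, ∑ j, wol i j * (y j - y i) * (ur n j - ur n i) = 0 := by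
    intro n
    have h1 := sum_mul_laplacian wl hwl y (ur n)
    have h2 : ∑ i, ur n i * ∑ j, wl i j * (y j - y i) = 0 := by
      rw [← Finset.sum_fiberwise _ (Quotient.mk s)]
      refine Finset.sum_eq_zero fun I _ => ?_
      rw [Finset.sum_congr rfl fun i hi => by
        rw [show ur n i = u n (r I) by simp only [ur, (Finset.mem_filter.1 hi).2]],
        ← Finset.mul_sum, hyl, mul_zero]
    have h3 : ∑ i, ∑ j, wol i j * (y j - y i) * (ur n j - ur n i) =
        ∑ i, ∑ j, wl i j * (y j - y i) * (ur n j - ur n i) := by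
      refine Finset.sum_congr rfl fun i _ => Finset.sum_congr rfl fun j _ => ?_
      by_cases h : P i j
      · simp only [wol, if_pos h]
      · simp only [wol, if_neg h, zero_mul]
        rcases hcases i j h with h | h | h
        · simp [hwl0 i j h]
        · simp [hurΔ n i h.1, hurΔ n j h.2]
        · rw [hy i j h]; ring
    linarith
  have hQ0 : Tendsto Q atTop (𝓝 0) := by
    -- Subtracting the vanishing sum `hzero` leaves a bounded factor times a weight error, and a
    -- fixed factor times the deviation of `u` from `ur`.
    have h : ∀ n, Q n = -∑ i, ∑ j, ((y j - y i) * ((u n j - u n i) * (wo n i j - wol i j)) +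
        wol i j * (y j - y i) * ((u n j - ur n j) - (u n i - ur n i))) := by
      intro n
      rw [hQ, neg_inj, ← sub_zero (∑ i, ∑ j, wo n i j * (y j - y i) * (u n j - u n i)), ← hzero n]
      simp only [← Finset.sum_sub_distrib]
      exact Finset.sum_congr rfl fun i _ => Finset.sum_congr rfl fun j _ => by ring
    have hlim0 : ∀ i j, Tendsto (fun n => (y j - y i) * ((u n j - u n i) * (wo n i j - wol i j)) +
        wol i j * (y j - y i) * ((u n j - ur n j) - (u n i - ur n i))) atTop (𝓝 0) := by
      intro i j
      have h1 : Tendsto (fun n => (u n j - u n i) * (wo n i j - wol i j)) atTop (𝓝 0) := by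
        by_cases hP : P i j
        · exact bdd_le_mul_tendsto_zero' _ (hbdd i j hP)
            (by simpa using (hwo i j).sub_const (wol i j))
        · simp [wo, wol, if_neg hP]
      simpa using (h1.const_mul (y j - y i)).add
        (((hur j).sub (hur i)).const_mul (wol i j * (y j - y i)))
    have := (tendsto_finsetSum Finset.univ fun i _ =>
      tendsto_finsetSum Finset.univ fun j _ => hlim0 i j).neg
    simp only [Finset.sum_const_zero, neg_zero] at this
    exact this.congr fun n => (h n).symm
  have hadj : ∀ i j, G.Adj i j → Tendsto (fun n => u n j - u n i) atTop (𝓝 0) := by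
    intro i j hij
    by_cases hI : Quotient.mk s i = Quotient.mk s j
    · exact hctr i j hij hI
    by_cases hoff : s(i, j) ∈ edgesOff G Δ
    · obtain ⟨h1, h2⟩ := hlim i j hoff hI
      refine tendsto_zero_of_sq (squeeze_zero' (Eventually.of_forall fun n => sq_nonneg _)
        (Eventually.of_forall fun n => ?_) (by simpa using hQ0.div h2 h1.ne'))
      show _ ≤ Q n / w n i j
      rw [le_div_iff₀' (hpos n i j hoff)]
      exact hterm n i j
    · rw [mem_edgesOff] at hoff
      have h2 : i ∈ Δ ∧ j ∈ Δ := by tauto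
      simp [huΔ _ i h2.1, huΔ _ j h2.2]
  obtain ⟨a, ha⟩ := hΔ
  have h := tendsto_sub_of_reachable hadj (hG.preconnected a i)
  simp only [huΔ _ a ha, sub_zero] at h
  simpa [u] using h.add_const (y i)

end Convergence

/-! ### Stresses under contraction and the forces along the triangle sides -/

section Contraction

variable {V : Type*}

lemma contract_edgesOff {G : SimpleGraph V} {s : Setoid V} {Δ : Set V} {e : Sym2 V}
    (he : e ∈ G.edgeSet) (h : e.map (Quotient.mk s) ∈ edgesOff (contract G s) (Quotient.mk s '' Δ)) :
    e ∈ edgesOff G Δ := by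
  refine ⟨he, fun h2 => h.2 fun I hI => ?_⟩
  obtain ⟨i, hi, rfl⟩ := Sym2.mem_map.1 hI
  exact ⟨i, h2 i hi, rfl⟩

open Classical in
/-- The stress on `G` that agrees with `ωhat` off the triangle and contracts to `ω'`. -/
noncomputable def liftStress (G : SimpleGraph V) (s : Setoid V) (Δ : Set V) (ωhat : Sym2 V → ℝ)
    (ω' : Sym2 (Quotient s) → ℝ) (e : Sym2 V) : ℝ :=
  if e ∈ edgesOff G Δ then ωhat e else ω' (e.map (Quotient.mk s)) -
    ∑ᶠ d ∈ {d : Sym2 V | d ∈ edgesOff G Δ ∧ d.map (Quotient.mk s) = e.map (Quotient.mk s)}, ωhat d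

lemma liftStress_of_mem {G : SimpleGraph V} {s : Setoid V} {Δ : Set V} {e : Sym2 V}
    (he : e ∈ edgesOff G Δ) (ωhat : Sym2 V → ℝ) (ω' : Sym2 (Quotient s) → ℝ) :
    liftStress G s Δ ωhat ω' e = ωhat e := if_pos he

variable [Fintype V]

-- As `I ≠ J`, every edge between the two classes has exactly one orientation from `I` to `J`, so
-- unordered edges correspond to ordered pairs.
open Classical in
lemma contractStress_mk (G : SimpleGraph V) (s : Setoid V) (ω : Sym2 V → ℝ) {I J : Quotient s}
    (hIJ : I ≠ J) : contractStress G s ω s(I, J) =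
      ∑ i with Quotient.mk s i = I, ∑ j with Quotient.mk s j = J, weight G ω i j := by
  rw [← Finset.sum_product']
  have h : ∑ p ∈ Finset.univ.filter (fun i => Quotient.mk s i = I) ×ˢ
      Finset.univ.filter (fun j => Quotient.mk s j = J), weight G ω p.1 p.2 =
      ∑ᶠ p ∈ {p : V × V | G.Adj p.1 p.2 ∧ Quotient.mk s p.1 = I ∧ Quotient.mk s p.2 = J},
        ω s(p.1, p.2) := by
    rw [finsum_mem_eq_finite_toFinset_sum _ (Set.toFinite _)]
    symm
    refine Finset.sum_subset_zero_on_sdiff (fun p hp => ?_) (fun p hp => ?_) (fun p hp => ?_)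
    · simp at hp ⊢; exact hp.2
    · simp at hp
      exact weight_of_not_adj (fun h => hp.2 h hp.1.1 hp.1.2) ω
    · simp at hp
      exact (weight_of_adj hp.1 ω).symm
  rw [h]
  symm
  refine finsum_mem_eq_of_bijOn (fun p : V × V => s(p.1, p.2)) ⟨?_, ?_, ?_⟩ fun p _ => rfl
  · rintro ⟨i, j⟩ ⟨h1, h2, h3⟩
    refine ⟨h1, ?_⟩
    simp_all
  · rintro ⟨i, j⟩ ⟨h1, h2, h3⟩ ⟨i', j'⟩ ⟨h1', h2', h3'⟩ h
    simp only [Sym2.eq_iff] at h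
    rcases h with ⟨rfl, rfl⟩ | ⟨rfl, rfl⟩
    · rfl
    · exact absurd (h2.symm.trans h3') hIJ
  · intro e
    induction e with
    | _ i j =>
      rintro ⟨h1, h2⟩
      simp only [Sym2.map_mk, Sym2.eq_iff] at h2
      rcases h2 with ⟨h2, h3⟩ | ⟨h2, h3⟩
      · exact ⟨(i, j), ⟨h1, h2, h3⟩, rfl⟩
      · exact ⟨(j, i), ⟨SimpleGraph.Adj.symm h1, h3, h2⟩, Sym2.eq_swap⟩

open Classical in
/-- The equilibrium condition on the contracted graph is the sum over a class of the equilibrium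
conditions on the graph. -/
lemma sum_laplacian_class (G : SimpleGraph V) (s : Setoid V) [Fintype (Quotient s)]
    {ω : Sym2 V → ℝ} {ω' : Sym2 (Quotient s) → ℝ}
    (hω' : ∀ E ∈ (contract G s).edgeSet, ω' E = contractStress G s ω E) (y : Quotient s → ℝ)
    (I : Quotient s) :
    ∑ i with Quotient.mk s i = I, ∑ j, weight G ω i j * (y (Quotient.mk s j) - y (Quotient.mk s i))
      = ∑ J, weight (contract G s) ω' I J * (y J - y I) := by
  have h : ∀ J, weight (contract G s) ω' I J * (y J - y I) =
      ∑ i with Quotient.mk s i = I, ∑ j with Quotient.mk s j = J,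
        weight G ω i j * (y (Quotient.mk s j) - y (Quotient.mk s i)) := by
    intro J
    trans ∑ i with Quotient.mk s i = I, ∑ j with Quotient.mk s j = J, weight G ω i j * (y J - y I)
    swap
    · refine Finset.sum_congr rfl fun i hi => Finset.sum_congr rfl fun j hj => ?_
      rw [(Finset.mem_filter.1 hi).2, (Finset.mem_filter.1 hj).2]
    simp only [← Finset.sum_mul]
    by_cases hIJ : I = J
    · simp [hIJ]
    rw [← contractStress_mk G s ω hIJ]
    by_cases hadj : (contract G s).Adj I J
    · rw [weight_of_adj hadj, hω' _ hadj]
    · rw [weight_of_not_adj hadj, contractStress_mk G s ω hIJ]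
      congr 1
      refine (Finset.sum_eq_zero fun i hi => Finset.sum_eq_zero fun j hj =>
        weight_of_not_adj (fun hij => hadj ?_) ω).symm
      exact ⟨hIJ, i, j, hij, (Finset.mem_filter.1 hi).2, (Finset.mem_filter.1 hj).2⟩
  simp only [h]
  symm
  rw [Finset.sum_comm]
  exact Finset.sum_congr rfl fun i _ => Finset.sum_fiberwise _ _ _

open Classical in
/-- The force exerted on the class of `a` along the sides of the triangle converges. -/
lemma tendsto_side_forces {G : SimpleGraph V} {s : Setoid V} {a b c : V} (hbc : b ≠ c)
    (hIb : Quotient.mk s b ≠ Quotient.mk s a) (hIc : Quotient.mk s c ≠ Quotient.mk s a)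
    {w : ℕ → V → V → ℝ} {wl : V → V → ℝ}
    (hw : ∀ n i j, w n i j = w n j i) (hwl : ∀ i j, wl i j = wl j i)
    (hw0 : ∀ n i j, ¬ G.Adj i j → w n i j = 0) (hwl0 : ∀ i j, ¬ G.Adj i j → wl i j = 0)
    (hlim : ∀ i j, s(i, j) ∈ edgesOff G {a, b, c} → Quotient.mk s i ≠ Quotient.mk s j →
      Tendsto (fun n => w n i j) atTop (𝓝 (wl i j)))
    {x : ℕ → V → ℝ} {y : V → ℝ}
    (hx : ∀ n i, ∑ j, w n i j * (x n j - x n i) = 0)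
    (hyl : ∀ I, ∑ i with Quotient.mk s i = I, ∑ j, wl i j * (y j - y i) = 0)
    (hxy : ∀ n, ∀ i ∈ ({a, b, c} : Set V), x n i = y i)
    (hlimx : ∀ i, Tendsto (fun n => x n i) atTop (𝓝 (y i))) :
    Tendsto (fun n => (w n a b - wl a b) * (y b - y a) + (w n a c - wl a c) * (y c - y a))
      atTop (𝓝 0) := by
  let g : ℕ → V → V → ℝ := fun n i j => w n i j * (x n j - x n i) - wl i j * (y j - y i)
  -- `g` is the force on `i` from `j` minus its candidate limit; `t` isolates the two sides at `a`,
  -- whose stresses are not yet known to converge.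
  let t : ℕ → V → V → ℝ := fun n i j => if i = a ∧ (j = b ∨ j = c) then g n i j else 0
  have hg0 : ∀ n, ∑ i with Quotient.mk s i = Quotient.mk s a,
      ∑ j with ¬ Quotient.mk s j = Quotient.mk s a, g n i j = 0 := by
    intro n
    have h1 : ∑ i with Quotient.mk s i = Quotient.mk s a, ∑ j, g n i j = 0 := by
      simp only [g, Finset.sum_sub_distrib, hx, hyl, Finset.sum_const_zero, sub_zero]
    -- Action equals reaction: forces inside the class cancel, however large their stresses.
    have h2 := sum_antisymm_block (fun i => Quotient.mk s i = Quotient.mk s a) (g n)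
      (fun i j => by simp only [g, hw n i j, hwl i j]; ring)
    simp only [← Finset.sum_filter_add_sum_filter_not Finset.univ
      (fun j => Quotient.mk s j = Quotient.mk s a) (g n _), Finset.sum_add_distrib, h2,
      zero_add] at h1
    exact h1
  have hts : ∀ n, ∑ i with Quotient.mk s i = Quotient.mk s a,
      ∑ j with ¬ Quotient.mk s j = Quotient.mk s a, t n i j =
      (w n a b - wl a b) * (y b - y a) + (w n a c - wl a c) * (y c - y a) := by
    intro n
    rw [Finset.sum_eq_single_of_mem a (by simp) fun i _ hi =>
      Finset.sum_eq_zero fun j _ => if_neg fun h => hi h.1]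
    rw [← Finset.sum_subset (s₁ := {b, c})
      (fun j hj => by
        simp only [Finset.mem_insert, Finset.mem_singleton] at hj
        rcases hj with rfl | rfl <;> simpa)
      (fun j _ hj => if_neg fun h => hj (by simpa using h.2)), Finset.sum_pair hbc]
    simp [g, hxy]
    ring
  have hsub : ∀ i j, Quotient.mk s i = Quotient.mk s a → ¬ Quotient.mk s j = Quotient.mk s a →
      Tendsto (fun n => g n i j - t n i j) atTop (𝓝 0) := by
    intro i j hi hj
    by_cases hT : i = a ∧ (j = b ∨ j = c)
    · simp only [t, if_pos hT, sub_self, tendsto_const_nhds]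
    simp only [t, if_neg hT, sub_zero]
    by_cases hadj : G.Adj i j
    · have hoff : s(i, j) ∈ edgesOff G {a, b, c} := by
        refine mem_edgesOff.2 ⟨hadj, fun h => hT ?_⟩
        obtain ⟨h1, h2⟩ := h
        simp only [Set.mem_insert_iff, Set.mem_singleton_iff] at h1 h2
        grind
      have h := ((hlim i j hoff (fun h => hj (h.symm.trans hi))).mul
        ((hlimx j).sub (hlimx i))).sub_const (wl i j * (y j - y i))
      simpa using h
    · simp [g, hw0 _ i j hadj, hwl0 i j hadj]
  have h := (tendsto_finsetSum (Finset.univ.filter fun i => Quotient.mk s i = Quotient.mk s a)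
    fun i hi => tendsto_finsetSum
      (Finset.univ.filter fun j => ¬ Quotient.mk s j = Quotient.mk s a)
      fun j hj => hsub i j (Finset.mem_filter.1 hi).2 (Finset.mem_filter.1 hj).2).neg
  simp only [Finset.sum_sub_distrib, hg0, hts, Finset.sum_const_zero, neg_zero, zero_sub,
    neg_neg] at h
  exact h

/-- Over a side of the image triangle lies exactly one side of `Δ`, since the corners are in
different classes. Its value is free and supplies whatever the other edges in the fibre leave over.
-/
lemma contractStress_liftStress {G : SimpleGraph V} {s : Setoid V} {Δ : Set V}
    (hclique : G.IsClique Δ)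
    (hinj : ∀ i ∈ Δ, ∀ j ∈ Δ, Quotient.mk s i = Quotient.mk s j → i = j)
    {ωhat : Sym2 V → ℝ} {ω' : Sym2 (Quotient s) → ℝ}
    (hω' : ∀ E ∈ edgesOff (contract G s) (Quotient.mk s '' Δ), ω' E = contractStress G s ωhat E)
    {E : Sym2 (Quotient s)} (hE : E ∈ (contract G s).edgeSet) :
    ω' E = contractStress G s (liftStress G s Δ ωhat ω') E := by
  by_cases hoff : E ∈ edgesOff (contract G s) (Quotient.mk s '' Δ)
  · rw [hω' E hoff]
    refine finsum_mem_congr rfl fun e he => (liftStress_of_mem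
      (contract_edgesOff (s := s) he.1 (by rw [he.2]; exact hoff)) _ _).symm
  have hmem : ∀ I ∈ E, I ∈ Quotient.mk s '' Δ := by
    by_contra h
    exact hoff ⟨hE, h⟩
  induction E with
  | _ I J =>
    obtain ⟨a, ha, rfl⟩ := hmem I (Sym2.mem_mk_left _ _)
    obtain ⟨b, hb, rfl⟩ := hmem J (Sym2.mem_mk_right _ _)
    have hab : a ≠ b := fun h => hE.1 (by rw [h])
    have hnot : s(a, b) ∉ edgesOff G Δ := fun h => (mem_edgesOff.1 h).2 ⟨ha, hb⟩
    have hset : {e : Sym2 V | e ∈ G.edgeSet ∧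
        e.map (Quotient.mk s) = s(Quotient.mk s a, Quotient.mk s b)} =
        insert s(a, b) {d : Sym2 V | d ∈ edgesOff G Δ ∧
          d.map (Quotient.mk s) = s(a, b).map (Quotient.mk s)} := by
      ext e
      constructor
      · rintro ⟨h1, h2⟩
        by_cases h3 : e ∈ edgesOff G Δ
        · exact Or.inr ⟨h3, h2⟩
        · left
          induction e with
          | _ i j =>
            rw [mem_edgesOff] at h3
            have h4 : i ∈ Δ ∧ j ∈ Δ := by
              by_contra h5; exact h3 ⟨h1, h5⟩
            simp only [Sym2.map_mk, Sym2.eq_iff] at h2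
            rcases h2 with ⟨h5, h6⟩ | ⟨h5, h6⟩
            · rw [hinj _ h4.1 _ ha h5, hinj _ h4.2 _ hb h6]
            · rw [hinj _ h4.1 _ hb h5, hinj _ h4.2 _ ha h6, Sym2.eq_swap]
      · rintro (rfl | ⟨h1, h2⟩)
        · exact ⟨hclique ha hb hab, rfl⟩
        · exact ⟨h1.1, h2⟩
    rw [contractStress, hset, finsum_mem_insert _ (fun h => hnot h.1) (Set.toFinite _)]
    rw [liftStress, if_neg hnot]
    rw [finsum_mem_congr rfl fun e (he : e ∈ {d : Sym2 V | d ∈ edgesOff G Δ ∧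
      d.map (Quotient.mk s) = s(a, b).map (Quotient.mk s)}) => liftStress_of_mem he.1 ωhat ω']
    simp

end Contraction

/-! ### The contracted Tutte embedding and the limit theorem -/

section Limit

variable {V : Type*}

lemma IsThreeConnected.connected {G : SimpleGraph V} (h : IsThreeConnected G) : G.Connected := by
  have h2 := h.2 ∅ (by simp)
  rw [Set.compl_empty] at h2
  exact (SimpleGraph.induceUnivIso G).connected_iff.1 h2

lemma exists_third {Δ : Set V} (hΔ : Δ.ncard = 3) {i j : V} (hi : i ∈ Δ) (hj : j ∈ Δ)
    (hij : i ≠ j) : ∃ k, Δ = {i, j, k} ∧ k ≠ i ∧ k ≠ j := by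
  obtain ⟨a, b, c, hab, hac, hbc, rfl⟩ := Set.ncard_eq_three.1 hΔ
  simp only [Set.mem_insert_iff, Set.mem_singleton_iff] at hi hj
  have : ∃ k ∈ ({a, b, c} : Set V), k ≠ i ∧ k ≠ j := by
    simp only [Set.mem_insert_iff, Set.mem_singleton_iff, exists_eq_or_imp, exists_eq_left]
    grind
  obtain ⟨k, hk, hki, hkj⟩ := this
  refine ⟨k, ?_, hki, hkj⟩
  ext l
  simp only [Set.mem_insert_iff, Set.mem_singleton_iff] at hk ⊢
  grind

variable [Finite V]

lemma Persists.injOn {s : Setoid V} {Δ : Set V} (h : Persists s Δ) (hΔ : Δ.ncard = 3) :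
    ∀ i ∈ Δ, ∀ j ∈ Δ, Quotient.mk s i = Quotient.mk s j → i = j := fun _ hi _ hj hij =>
  Set.injOn_of_ncard_image_eq
    (le_antisymm (Set.ncard_image_le Δ.toFinite) (hΔ.trans_le h)) Δ.toFinite hi hj hij

lemma contractStress_pos {G : SimpleGraph V} {s : Setoid V} {Δ : Set V} {ω : Sym2 V → ℝ}
    (hω : ∀ i j, s(i, j) ∈ edgesOff G Δ → Quotient.mk s i ≠ Quotient.mk s j → 0 < ω s(i, j))
    {E : Sym2 (Quotient s)} (hE : E ∈ edgesOff (contract G s) (Quotient.mk s '' Δ)) :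
    0 < contractStress G s ω E := by
  have hpos : ∀ e ∈ {e : Sym2 V | e ∈ G.edgeSet ∧ e.map (Quotient.mk s) = E}, 0 < ω e := by
    rintro e ⟨he, rfl⟩
    have hoff := contract_edgesOff he hE
    induction e with
    | _ i j => exact hω i j hoff hE.1.1
  rw [contractStress, finsum_mem_eq_finite_toFinset_sum _ (Set.toFinite _)]
  refine Finset.sum_pos (fun e he => hpos e (by simpa using he)) ?_
  induction E with
  | _ I J =>
    obtain ⟨-, i, j, hij, rfl, rfl⟩ := hE.1
    exact ⟨s(i, j), by simpa using hij⟩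

lemma exists_contracted_isTutteEmbedding {G : SimpleGraph V} {s : Setoid V}
    (hG' : (contract G s).Connected) {Δ : Set V} (hΔ : Δ.ncard = 3) (hclique : G.IsClique Δ)
    (hinj : ∀ i ∈ Δ, ∀ j ∈ Δ, Quotient.mk s i = Quotient.mk s j → i = j) {ωhat : Sym2 V → ℝ}
    (hpos : ∀ i j, s(i, j) ∈ edgesOff G Δ → Quotient.mk s i ≠ Quotient.mk s j → 0 < ωhat s(i, j))
    {v₀ : V → Plane} (hv₀ : AffineIndependent ℝ (fun i : Δ => v₀ i)) :
    ∃ v' ω', IsTutteEmbedding (contract G s) (Quotient.mk s '' Δ) (contractStress G s ωhat) v' ω' ∧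
      ∀ i ∈ Δ, v' (Quotient.mk s i) = v₀ i := by
  have := Fintype.ofFinite (Quotient s)
  obtain ⟨r, hr, hrΔ⟩ := exists_section s hinj
  have hadj : ∀ i ∈ Δ, ∀ j ∈ Δ, i ≠ j → (contract G s).Adj (Quotient.mk s i) (Quotient.mk s j) :=
    fun i hi j hj hij => ⟨fun h => hij (hinj i hi j hj h), i, j, hclique hi hj hij, rfl, rfl⟩
  let f : (Quotient.mk s '' Δ : Set (Quotient s)) ↪ Δ :=
    ⟨fun I => ⟨r I, by obtain ⟨_, a, ha, rfl⟩ := I; rwa [hrΔ a ha]⟩, fun I J h => by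
      have h1 : r I = r J := congrArg Subtype.val h
      exact Subtype.ext (by rw [← hr I, h1, hr J])⟩
  have hp : AffineIndependent ℝ
      (fun I : (Quotient.mk s '' Δ : Set (Quotient s)) => v₀ (r I)) := hv₀.comp_embedding f
  obtain ⟨a, b, c, hab, hac, hbc, rfl⟩ := Set.ncard_eq_three.1 hΔ
  have himage : Quotient.mk s '' {a, b, c} =
      {Quotient.mk s a, Quotient.mk s b, Quotient.mk s c} := by
    simp [Set.image_insert_eq]
  have hpos' := fun E => contractStress_pos (E := E) hpos
  rw [himage] at hp hpos' ⊢
  obtain ⟨v', ω', h1, h2⟩ := exists_isTutteEmbedding hG' (hadj a (by simp) b (by simp) hab)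
    (hadj a (by simp) c (by simp) hac) (hadj b (by simp) c (by simp) hbc) hpos'
    (fun I => v₀ (r I)) hp
  refine ⟨v', ω', h1, fun i hi => ?_⟩
  rw [h2 _ (by rw [← himage]; exact ⟨i, hi, rfl⟩), hrΔ i hi]

end Limit

end TutteLimit

theorem lemmaA2 {V : Type*} [Finite V] (G : SimpleGraph V) (s : Setoid V)
    (hG : TutteLimit.IsPolyhedral G)
    (hs : TutteLimit.IsContraction G s)
    (hG' : TutteLimit.IsPolyhedral (TutteLimit.contract G s))
    (Δ : Set V) (hΔ : TutteLimit.IsTriangularFace G Δ)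
    (hpersist : TutteLimit.Persists s Δ)
    -- the positive partial stresses and their limit on the non-contracted edges
    (ωhat : ℕ → Sym2 V → ℝ) (ωhatlim : Sym2 V → ℝ)
    (hpos : ∀ n, ∀ e ∈ TutteLimit.edgesOff G Δ, 0 < ωhat n e)
    (hconv : ∀ i j : V, s(i, j) ∈ TutteLimit.edgesOff G Δ → Quotient.mk s i ≠ Quotient.mk s j →
      0 < ωhatlim s(i, j) ∧
        Tendsto (fun n => ωhat n s(i, j)) atTop (𝓝 (ωhatlim s(i, j))))
    (hdiv : ∀ i j : V, s(i, j) ∈ TutteLimit.edgesOff G Δ → Quotient.mk s i = Quotient.mk s j →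
      Tendsto (fun n => ωhat n s(i, j)) atTop atTop)
    -- the Tutte embeddings with a fixed outer triangle
    (v₀ : V → TutteLimit.Plane) (hv₀ : AffineIndependent ℝ (fun i : Δ => v₀ i))
    (v : ℕ → V → TutteLimit.Plane) (ω : ℕ → Sym2 V → ℝ)
    (hTutte : ∀ n, TutteLimit.IsTutteEmbedding G Δ (ωhat n) (v n) (ω n))
    (hfix : ∀ n, ∀ i ∈ Δ, v n i = v₀ i) :
    -- the Tutte embedding of the contracted graph for the contracted partial stress exists
    (∃ (v' : Quotient s → TutteLimit.Plane) (ω' : Sym2 (Quotient s) → ℝ),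
      TutteLimit.IsTutteEmbedding (TutteLimit.contract G s) (Quotient.mk s '' Δ)
        (TutteLimit.contractStress G s ωhatlim) v' ω' ∧
      ∀ i ∈ Δ, v' (Quotient.mk s i) = v₀ i) ∧
    -- and every such Tutte embedding is the limit
    ∀ (v' : Quotient s → TutteLimit.Plane) (ω' : Sym2 (Quotient s) → ℝ),
      TutteLimit.IsTutteEmbedding (TutteLimit.contract G s) (Quotient.mk s '' Δ)
        (TutteLimit.contractStress G s ωhatlim) v' ω' →
      (∀ i ∈ Δ, v' (Quotient.mk s i) = v₀ i) →
      ∃ (vlim : V → TutteLimit.Plane) (ωlim : Sym2 V → ℝ),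
        (∀ i j : V, s(i, j) ∈ TutteLimit.edgesOff G Δ → Quotient.mk s i ≠ Quotient.mk s j →
          ωlim s(i, j) = ωhatlim s(i, j)) ∧
        TutteLimit.FrameworksConverge G s v ω vlim ωlim ∧
        TutteLimit.IsContractedFramework G s vlim ωlim v' ω' := by
  open TutteLimit in
  classical
  have := Fintype.ofFinite V
  have := Fintype.ofFinite (Quotient s)
  obtain ⟨hΔ3, hclique, -⟩ := hΔ
  have hinj := hpersist.injOn hΔ3
  refine ⟨exists_contracted_isTutteEmbedding hG'.1.connected hΔ3 hclique hinj
    (fun i j h1 h2 => (hconv i j h1 h2).1) hv₀, ?_⟩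
  intro v' ω' hT hv'
  have hsum : ∀ E ∈ (contract G s).edgeSet,
      ω' E = contractStress G s (liftStress G s Δ ωhatlim ω') E := fun E hE =>
    contractStress_liftStress hclique hinj hT.extends_partial hE
  have hwoff : ∀ n i j, s(i, j) ∈ edgesOff G Δ → weight G (ω n) i j = ωhat n s(i, j) :=
    fun n i j h => by
      rw [weight_of_adj (mem_edgesOff.1 h).1, (hTutte n).extends_partial _ h]
  have hwloff : ∀ i j, s(i, j) ∈ edgesOff G Δ →
      weight G (liftStress G s Δ ωhatlim ω') i j = ωhatlim s(i, j) := fun i j h => by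
    rw [weight_of_adj (mem_edgesOff.1 h).1, liftStress_of_mem h]
  have hlim : ∀ i j, s(i, j) ∈ edgesOff G Δ → Quotient.mk s i ≠ Quotient.mk s j →
      0 < weight G (liftStress G s Δ ωhatlim ω') i j ∧
      Tendsto (fun n => weight G (ω n) i j) atTop
        (𝓝 (weight G (liftStress G s Δ ωhatlim ω') i j)) := fun i j h hI => by
    simpa only [hwloff i j h, hwoff _ i j h] using hconv i j h hI
  have hx : ∀ k n i, ∑ j, weight G (ω n) i j * (v n j k - v n i k) = 0 := fun k n i =>
    (isSelfStress_iff _ _ _).1 (hTutte n).isSelfStress i k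
  -- The lifted stress need not be in equilibrium at single vertices of `G`, only in total over each
  -- class.
  have hyl : ∀ k I, ∑ i with Quotient.mk s i = I, ∑ j,
      weight G (liftStress G s Δ ωhatlim ω') i j *
        (v' (Quotient.mk s j) k - v' (Quotient.mk s i) k) = 0 := fun k I => by
    rw [sum_laplacian_class G s hsum (fun J => v' J k) I]
    exact (isSelfStress_iff _ _ _).1 hT.isSelfStress I k
  have hxy : ∀ k n, ∀ i ∈ Δ, v n i k = v' (Quotient.mk s i) k := fun k n i hi => by
    rw [hfix n i hi, hv' i hi]
  have hΔne : Δ.Nonempty := Set.nonempty_of_ncard_ne_zero (by omega)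
  have hvk : ∀ k i, Tendsto (fun n => v n i k) atTop (𝓝 (v' (Quotient.mk s i) k)) := fun k i =>
    tendsto_of_laplacian hG.1.connected hs hΔne hinj (fun n => weight_comm G (ω n))
      (weight_comm G _) (fun n i j h => weight_of_not_adj h _) (fun i j h => weight_of_not_adj h _)
      (fun n i j h => by rw [hwoff n i j h]; exact hpos n _ h) hlim
      (fun i j h hI => by simpa only [hwoff _ i j h] using hdiv i j h hI)
      (x := fun n i => v n i k) (y := fun i => v' (Quotient.mk s i) k)
      (fun i j h => by rw [h]) (hx k) (hyl k) (hxy k) i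
  refine ⟨fun i => v' (Quotient.mk s i), liftStress G s Δ ωhatlim ω',
    fun i j h _ => liftStress_of_mem h _ _, ⟨fun i => ?_, fun i j hij hI => ?_⟩,
    fun _ => rfl, hsum⟩
  · exact (PiLp.homeomorph 2 (fun _ : Fin 2 => ℝ)).isInducing.tendsto_nhds_iff.2
      (tendsto_pi_nhds.2 fun k => hvk k i)
  · rw [← weight_of_adj hij (liftStress G s Δ ωhatlim ω')]
    simp only [← weight_of_adj hij (ω _)]
    by_cases hoff : s(i, j) ∈ edgesOff G Δ
    · exact (hlim i j hoff hI).2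
    have hmem : i ∈ Δ ∧ j ∈ Δ := by
      by_contra h; exact hoff (mem_edgesOff.2 ⟨hij, h⟩)
    -- For a side `ij`, the balance over the class of `i` involves the sides `ij` and `ik`; both
    -- coordinates together separate their two stress errors.
    obtain ⟨k, rfl, hki, hkj⟩ := exists_third hΔ3 hmem.1 hmem.2 hij.ne
    have hk : k ∈ ({i, j, k} : Set V) := by simp
    have hD := det_ne_zero_of_affineIndependent hv₀ hmem.1 hmem.2 hk hij.ne hki.symm hkj.symm
    simp only [← hv' i hmem.1, ← hv' j hmem.2, ← hv' k hk] at hD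
    have h := tendsto_zero_of_det_ne_zero
      (u := fun l => v' (Quotient.mk s j) l - v' (Quotient.mk s i) l)
      (v := fun l => v' (Quotient.mk s k) l - v' (Quotient.mk s i) l) hD
      fun l => tendsto_side_forces hkj.symm hI.symm
        (fun h => hki (hinj k hk i hmem.1 h)) (fun n => weight_comm G (ω n))
        (weight_comm G _) (fun n i j h => weight_of_not_adj h _)
        (fun i j h => weight_of_not_adj h _) (fun i j h hI => (hlim i j h hI).2)
        (x := fun n i => v n i l) (y := fun i => v' (Quotient.mk s i) l)
        (hx l) (hyl l) (hxy l) (hvk l)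
    simpa using h.add_const (weight G (liftStress G s {i, j, k} ωhatlim ω') i j)
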